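/- Let $d\ge 2$ and let $\{v_1,\dots,v_d\}$ be a basis of $\mathbb{R}^d$ such that $\langle v_i,v_d\rangle=\delta_{id}$ for all $i\le d$. Let $P=\{p_m : m\in\mathbb{Z}^{d-1}\}$ be the uniform set of parallel lines $p_m(t)=\sum_{i=1}^{d-1}m_iv_i+t\,v_d$, $t\in\mathbb{R}$. Let $u_1,\dots,u_{d-1}\in\mathbb{R}^d$ satisfy $\langle u_i,v_j\rangle=2\pi\delta_{ij}$ for $1\le i\le d-1$, $1\le j\le d$, and let $\Omega\subset\mathbb{R}^d$ be compact, convex and symmetric about the origin. Let $\mathcal{B}_\Omega$ be the set of $f\in L^2(\mathbb{R}^d)$ (complex valued, identified with their continuous representatives) whose Fourier transform $F(\omega)=\int f(r)e^{-\mathrm{i}\langle\omega,r\rangle}\,dr$ vanishes almost everywhere outside $\Omega$. A set $\Lambda\subset\mathbb{R}^d$ is uniformly discrete if there is $r>0$ with $\|x-y\|>r$ for all distinct $x,y\in\Lambda$. A countable family $Q=\{q_i\}$ of trajectories (continuous functions $q_i:\mathbb{R}\to\mathbb{R}^d$; here differentiable) is called a Nyquist trajectory set for $\Omega$ if (C1)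 there is a uniformly discrete set $\Lambda$ of points on the trajectories of $Q$ such that any two fields in $\mathcal{B}_\Omega$ that agree on $\Lambda$ are equal; and (C2) for every $x\in\mathbb{R}^d$ there is a function $h(a)=o(a^d)$ as $a\to\infty$ such that for every $a>0$ there is a continuous curve of length at most $\mathcal{D}(a,x)+\max(h(a),0)$ that contains every point of the trajectories of $Q$ in the closed ball of radius $a$ around $x$, where $\mathcal{D}(a,x)=\sum_i\int_{\{t:\|q_i(t)-x\|\le a\}}\|q_i'(t)\|\,dt$ is the total arc length of the trajectories inside that ball. Then: 1. If $\frac12\sum_{i=1}^{d-1}m_iu_i\notin\Omega$ for every $m\in\mathbb{Z}^{d-1}\setminus\{0\}$, then $P$ is a Nyquist trajectory set for $\Omega$. 2. If there is $m\in\mathbb{Z}^{d-1}\setminus\{0\}$ such that $\frac12\sum_{i=1}^{d-1}m_iu_i$ lies in the interior of $\Omega$, then $P$ is not a Nyquist trajectory set for $\Omega$. -/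

import Mathlib

open MeasureTheory Filter Asymptotics Set
open scoped FourierTransform ENNReal

/-- A trajectory in `ℝ^d`: a continuous function of a real variable with values in `ℝ^d`. -/
abbrev Trajectory (d : ℕ) := C(ℝ, EuclideanSpace ℝ (Fin d))

/-- Fields bandlimited to `Ω ⊆ ℝ^d`: the `f ∈ L²(ℝ^d)` whose Fourier transform
`F(ω) = ∫ f(r) exp(-i⟨ω, r⟩) dr` vanishes (almost everywhere) off `Ω`. Since a field is evaluated
at points, it is taken to be the continuous representative of its `L²` class. Mathlib's `L²`
Fourier transform `𝓕` has the kernel `exp(-2πi⟨ξ, r⟩)`, hence `F(ω) = (𝓕 f)(ω / 2π)`. -/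
def bandlimitedFields {d : ℕ} (Ω : Set (EuclideanSpace ℝ (Fin d))) :
    Set (EuclideanSpace ℝ (Fin d) → ℂ) :=
  {f | Continuous f ∧ ∃ hf : MemLp f 2 (volume : Measure (EuclideanSpace ℝ (Fin d))),
    ∀ᵐ ω : EuclideanSpace ℝ (Fin d), ω ∉ Ω →
      (𝓕 (hf.toLp f) : Lp ℂ 2 (volume : Measure (EuclideanSpace ℝ (Fin d)))) ((2 * Real.pi)⁻¹ • ω) = 0}

/-- Uniformly discrete subsets of `ℝ^d`. -/
def UniformlyDiscrete {d : ℕ} (Λ : Set (EuclideanSpace ℝ (Fin d))) : Prop :=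
  ∃ r : ℝ, 0 < r ∧ ∀ x ∈ Λ, ∀ y ∈ Λ, x ≠ y → r < ‖x - y‖

/-- The collection of all uniformly discrete sets `Λ` such that every field bandlimited to `Ω` is
uniquely determined, among the fields bandlimited to `Ω`, by its values on `Λ`. -/
def samplingSets {d : ℕ} (Ω : Set (EuclideanSpace ℝ (Fin d))) :
    Set (Set (EuclideanSpace ℝ (Fin d))) :=
  {Λ | UniformlyDiscrete Λ ∧
    ∀ f ∈ bandlimitedFields Ω, ∀ g ∈ bandlimitedFields Ω, (∀ x ∈ Λ, f x = g x) → f = g}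

/-- Total arc length of the portions of the (differentiable) trajectories `p i` that lie in the
closed ball of radius `a` around `x`:
`∑ i, ∫_{t : ‖p i t - x‖ ≤ a} ‖(p i)'(t)‖ dt`. -/
noncomputable def arcLengthInBall {d : ℕ} {ι : Type*} (p : ι → Trajectory d)
    (a : ℝ) (x : EuclideanSpace ℝ (Fin d)) : ℝ≥0∞ :=
  ∑' i, ∫⁻ t in {t : ℝ | ‖p i t - x‖ ≤ a}, ‖deriv (p i) t‖ₑ

/-- Nyquist condition: some uniformly discrete set of points on the trajectories admits perfect
reconstruction of the fields bandlimited to `Ω`. -/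
def NyquistCondition {d : ℕ} {ι : Type*} (Ω : Set (EuclideanSpace ℝ (Fin d)))
    (p : ι → Trajectory d) : Prop :=
  ∃ Λ : Set (EuclideanSpace ℝ (Fin d)), Λ ⊆ {y | ∃ i t, p i t = y} ∧ Λ ∈ samplingSets Ω

/-- Non-degeneracy condition: for every `x`, the portion of the trajectories inside the ball of
radius `a` around `x` is contained in a continuous curve whose length is at most the total arc
length of that portion plus `o(a^d)` as `a → ∞`. The length of a curve is its total variation. -/
def NonDegenerate {d : ℕ} {ι : Type*} (p : ι → Trajectory d) : Prop :=
  ∀ x : EuclideanSpace ℝ (Fin d), ∃ h : ℝ → ℝ, (h =o[atTop] fun a : ℝ => a ^ d) ∧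
    ∀ a : ℝ, 0 < a → ∃ γ : Trajectory d,
      (∀ i t, ‖p i t - x‖ ≤ a → p i t ∈ range γ) ∧
      eVariationOn γ univ ≤ arcLengthInBall p a x + ENNReal.ofReal (h a)

/-- Nyquist trajectory sets for `Ω`: countable families of trajectories satisfying the Nyquist
condition and the non-degeneracy condition. -/
def IsNyquistTrajectorySet {d : ℕ} {ι : Type*} (Ω : Set (EuclideanSpace ℝ (Fin d)))
    (p : ι → Trajectory d) : Prop :=
  Countable ι ∧ NyquistCondition Ω p ∧ NonDegenerate p

/-- The uniform set of parallel lines in `ℝ^d`, `d = n + 1`, with generators `v_1, …, v_{d-1}` and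
direction `v_d`: the trajectories `p_m(t) = ∑_{i < d} m_i v_i + t v_d`, `m ∈ ℤ^{d-1}`. -/
noncomputable def uniformSet {n : ℕ} (v : Fin (n + 1) → EuclideanSpace ℝ (Fin (n + 1)))
    (m : Fin n → ℤ) : Trajectory (n + 1) where
  toFun t := ∑ i : Fin n, (m i : ℝ) • v i.castSucc + t • v (Fin.last n)
  continuous_toFun := by fun_prop

/-! Sampling. If `Ω` lies in the ball of radius `R`, sample on the lattice generated by `v_1, …,
v_{d-1}` and `(R + 1)⁻¹ v_d`. Suppose two points of `Ω` are congruent modulo `2π` times the dual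
lattice. Their difference has norm at most `2R`, too short for a nonzero `v_d`-component, so it is
`∑ k_i u_i`. By symmetry and convexity half of it lies in `Ω`, which the hypothesis excludes unless
`k = 0`. Hence the lattice characters separate the points of `Ω`. By Stone–Weierstrass their span is
dense in `C(Ω, ℂ)`, so a spectrum on `Ω` orthogonal to all of them vanishes
(`ae_eq_zero_of_fourierInv_eq_zero`, `bandlimitedFields.eq_zero`).

Non-degeneracy. A snake runs along the chords in a Gray code order of the lines. Neighbouring lines
are a bounded distance apart, and their half chords differ by `O(√a)` because the square root is
1/2-Hölder. With `O(a^(d-1))` crossings the overhead is `O(a^(d-1/2)) = o(a^d)`.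

Converse. For a half dual frequency `w` interior to `Ω`, take as spectrum a bump at `w` minus the
same bump at `-w`. The field is an envelope times a multiple of `sin ⟨w, ·⟩`, and `⟨w, ·⟩` takes
values in `πℤ` on every line. So (C1) fails for every choice of sample points on the lines. -/

/-! ### Uniqueness of a compactly supported spectrum from lattice samples. -/

section FourierUniqueness

variable {E : Type*} [NormedAddCommGroup E] [InnerProductSpace ℝ E]

/-- The character `ω ↦ exp (2πi⟨ω, x⟩)` restricted to a set. -/
noncomputable def restrictedChar (K : Set E) (x : E) : C(K, ℂ) where
  toFun ω := (Real.fourierChar (inner ℝ (ω : E) x) : ℂ)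
  continuous_toFun := by
    have := Real.continuous_fourierChar
    fun_prop

theorem restrictedChar_apply (K : Set E) (x : E) (ω : K) :
    restrictedChar K x ω = (Real.fourierChar (inner ℝ (ω : E) x) : ℂ) := rfl

/-- The star subalgebra of `C(K, ℂ)` generated by the characters with frequencies in `L`. -/
noncomputable def restrictedCharSubalgebra (K : Set E) (L : AddSubgroup E) :
    StarSubalgebra ℂ C(K, ℂ) where
  toSubalgebra := Algebra.adjoin ℂ (restrictedChar K '' L)
  star_mem' := by
    change Algebra.adjoin ℂ (restrictedChar K '' L) ≤ star (Algebra.adjoin ℂ (restrictedChar K '' L))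
    refine Algebra.adjoin_le ?_
    rintro - ⟨x, hx, rfl⟩
    refine Algebra.subset_adjoin ⟨-x, L.neg_mem hx, ?_⟩
    ext ω
    simp [restrictedChar_apply, AddChar.map_neg_eq_inv]

/-- The characters already form a monoid, since frequencies add under multiplication. A linear
functional therefore only has to be checked on single characters. -/
theorem restrictedCharSubalgebra_coe (K : Set E) (L : AddSubgroup E) :
    Subalgebra.toSubmodule (restrictedCharSubalgebra K L).toSubalgebra =
      Submodule.span ℂ (restrictedChar K '' L) := by
  apply Algebra.adjoin_eq_span_of_subset
  refine Subset.trans ?_ Submodule.subset_span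
  intro φ hφ
  refine Submonoid.closure_induction (fun _ => id) ⟨0, L.zero_mem, ?_⟩ ?_ hφ
  · ext ω
    simp [restrictedChar_apply]
  · rintro - - - - ⟨x, hx, rfl⟩ ⟨y, hy, rfl⟩
    refine ⟨x + y, L.add_mem hx hy, ?_⟩
    ext ω
    simp [restrictedChar_apply, inner_add_right, AddChar.map_add_eq_mul]

variable [FiniteDimensional ℝ E] [MeasurableSpace E] [BorelSpace E]

theorem Real.fourierChar_eq_one_iff (x : ℝ) : Real.fourierChar x = 1 ↔ ∃ k : ℤ, x = k := by
  rw [← Circle.coe_inj, Real.fourierChar_apply, Circle.coe_one, Complex.exp_eq_one_iff]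
  refine exists_congr fun k => ?_
  have hI : (2 * Real.pi * Complex.I : ℂ) ≠ 0 := Complex.two_pi_I_ne_zero
  constructor
  · intro h
    have h' : ((x : ℝ) : ℂ) = ((k : ℝ) : ℂ) := by
      apply mul_right_cancel₀ hI
      push_cast at h ⊢
      linear_combination h
    exact_mod_cast h'
  · rintro rfl
    push_cast
    ring

theorem Real.fourierInv_continuous_of_integrable {F : E → ℂ} (hF : Integrable F) :
    Continuous (𝓕⁻ F) := by
  rw [Real.fourierInv_eq_fourier_comp_neg]
  exact VectorFourier.fourierIntegral_continuous Real.continuous_fourierChar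
    (innerSL ℝ).continuous₂ hF.comp_neg

theorem Real.integral_fourierInv_mul_eq {F G : E → ℂ} (hF : Integrable F) (hG : Integrable G) :
    ∫ x, 𝓕⁻ F x * G x = ∫ x, F x * 𝓕⁻ G x := by
  have h := VectorFourier.integral_bilin_fourierIntegral_eq_flip (ContinuousLinearMap.mul ℂ ℂ)
    (L := -innerₗ E) (μ := volume) (ν := volume) Real.continuous_fourierChar
    (continuous_inner (𝕜 := ℝ) (E := E)).neg hF hG
  have hL : (-innerₗ E).flip = -innerₗ E := by
    ext x y
    simp [real_inner_comm]
  rw [hL] at h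
  exact h

/-- A continuous square integrable function with integrable Fourier transform is given pointwise
by the Fourier inversion integral. -/
theorem Continuous.eq_fourierInv_of_memLp {f : E → ℂ} (hc : Continuous f) (hf : MemLp f 2)
    (hF : Integrable (𝓕 (hf.toLp f) : Lp ℂ 2 (volume : Measure E))) :
    f = 𝓕⁻ ((𝓕 (hf.toLp f) : Lp ℂ 2 (volume : Measure E)) : E → ℂ) := by
  set F : Lp ℂ 2 (volume : Measure E) := 𝓕 (hf.toLp f) with hFdef
  have hcF := Real.fourierInv_continuous_of_integrable hF
  rw [← hc.ae_eq_iff_eq volume hcF]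
  refine ae_eq_of_integral_contDiff_smul_eq hc.locallyIntegrable hcF.locallyIntegrable
    fun g hg hgs => ?_
  -- Paired with a Schwartz function, the `L²` inversion formula becomes one for tempered
  -- distributions, where the inverse transform moves onto the test function.
  let G : SchwartzMap E ℂ := (hgs.comp_left (g := Complex.ofReal) rfl).toSchwartzMap
    (Complex.ofRealCLM.contDiff.comp hg)
  have hG : ∀ x, G x = g x := fun x => rfl
  have h1 : Lp.toTemperedDistribution (hf.toLp f) G = ∫ x, g x • f x := by
    rw [Lp.toTemperedDistribution_apply]
    apply integral_congr_ae
    filter_upwards [hf.coeFn_toLp] with x hx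
    simp [hx, hG]
  have h2 : hf.toLp f = 𝓕⁻ F := by rw [hFdef, FourierTransform.fourierInv_fourier_eq]
  rw [← h1, h2, ← Lp.fourierInv_toTemperedDistribution_eq, TemperedDistribution.fourierInv_apply,
    Lp.toTemperedDistribution_apply, SchwartzMap.fourierInv_coe]
  have h3 := Real.integral_fourierInv_mul_eq hF G.integrable
  simp only [smul_eq_mul, Complex.real_smul, ← hG]
  simp only [mul_comm] at h3 ⊢
  exact h3.symm

/-- Integration against `F` over `K`, as a continuous functional on `C(K, ℂ)`. -/
noncomputable def integralFunctional (K : Set E) [CompactSpace K] {F : E → ℂ} (hF : Integrable F) :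
    C(K, ℂ) →L[ℂ] ℂ :=
  have hFK : Integrable (fun ω : K => F ω) (volume.comap Subtype.val) :=
    (integrableOn_iff_comap_subtypeVal
      (isCompact_iff_compactSpace.2 ‹_› : IsCompact K).measurableSet).1 hF.integrableOn
  have hint (φ : C(K, ℂ)) : Integrable (fun ω : K => φ ω * F ω) (volume.comap Subtype.val) :=
    hFK.bdd_mul φ.continuous.aestronglyMeasurable (ae_of_all _ φ.norm_coe_le_norm)
  LinearMap.mkContinuous
    { toFun := fun φ => ∫ ω : K, φ ω * F ω ∂(volume.comap Subtype.val)
      map_add' := fun φ ψ => by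
        simp only [ContinuousMap.add_apply, add_mul]
        exact integral_add (hint φ) (hint ψ)
      map_smul' := fun c φ => by
        simp only [ContinuousMap.smul_apply, smul_eq_mul, mul_assoc, RingHom.id_apply]
        exact integral_const_mul _ _ }
    (∫ ω : K, ‖F ω‖ ∂(volume.comap Subtype.val)) (fun φ => by
      refine (norm_integral_le_integral_norm _).trans ?_
      rw [mul_comm, ← integral_const_mul]
      refine integral_mono (hint φ).norm (hFK.norm.const_mul _) fun ω => ?_
      simp only [norm_mul]
      gcongr
      exact φ.norm_coe_le_norm ω)

theorem integralFunctional_apply {K : Set E} [CompactSpace K] {F : E → ℂ} (hF : Integrable F)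
    (hFK : ∀ᵐ ω, ω ∉ K → F ω = 0) (φ : C(K, ℂ)) (g : E → ℂ) (hg : ∀ ω : K, φ ω = g ω) :
    integralFunctional K hF φ = ∫ ω, g ω * F ω := by
  change ∫ ω : K, φ ω * F ω ∂(volume.comap Subtype.val) = _
  have hm := (isCompact_iff_compactSpace.2 ‹_› : IsCompact K).measurableSet
  simp only [hg]
  rw [integral_subtype_comap hm (fun ω => g ω * F ω)]
  apply setIntegral_eq_integral_of_ae_compl_eq_zero
  filter_upwards [hFK] with ω h hω
  simp [h hω]

/-- An integrable function supported on a compact set `K` whose Fourier coefficients along a group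
`L` vanish is zero, provided that the characters in `L` separate the points of `K`. -/
theorem ae_eq_zero_of_fourierInv_eq_zero {K : Set E} (hK : IsCompact K) {F : E → ℂ}
    (hF : Integrable F) (hFK : ∀ᵐ ω, ω ∉ K → F ω = 0) (L : AddSubgroup E)
    (hsep : ∀ ω ∈ K, ∀ ω' ∈ K,
      (∀ x ∈ L, Real.fourierChar (inner ℝ (ω - ω') x) = 1) → ω = ω')
    (h0 : ∀ x ∈ L, 𝓕⁻ F x = 0) : F =ᵐ[volume] 0 := by
  have : CompactSpace K := isCompact_iff_compactSpace.1 hK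
  -- Stone–Weierstrass on the compact set `K`.
  have hdense : (restrictedCharSubalgebra K L).topologicalClosure = ⊤ := by
    apply ContinuousMap.starSubalgebra_topologicalClosure_eq_top_of_separatesPoints
    intro ω ω' hne
    by_contra hcon
    refine hne (Subtype.ext (hsep ω ω.2 ω' ω'.2 fun x hx => ?_))
    have : restrictedChar K x ω = restrictedChar K x ω' := by
      by_contra hx'
      exact hcon ⟨_, ⟨restrictedChar K x, Algebra.subset_adjoin ⟨x, hx, rfl⟩, rfl⟩, hx'⟩
    rw [restrictedChar_apply, restrictedChar_apply, Circle.coe_inj] at this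
    rw [inner_sub_left, AddChar.map_sub_eq_div, this, div_self']
  have hzero : ∀ φ ∈ restrictedCharSubalgebra K L, integralFunctional K hF φ = 0 := by
    intro φ hφ
    have hφ' : φ ∈ Submodule.span ℂ (restrictedChar K '' L) := by
      rw [← restrictedCharSubalgebra_coe]
      exact hφ
    have hle : Submodule.span ℂ (restrictedChar K '' L) ≤
        LinearMap.ker (integralFunctional K hF).toLinearMap := by
      rw [Submodule.span_le]
      rintro - ⟨x, hx, rfl⟩
      change integralFunctional K hF (restrictedChar K x) = 0
      rw [integralFunctional_apply hF hFK _
        (fun ω => (Real.fourierChar (inner ℝ ω x) : ℂ)) fun ω => rfl, ← h0 x hx,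
        Real.fourierInv_eq]
      rfl
    exact hle hφ'
  have hall : ∀ φ, integralFunctional K hF φ = 0 := by
    intro φ
    have hφ : φ ∈ closure (restrictedCharSubalgebra K L : Set C(K, ℂ)) := by
      rw [← StarSubalgebra.topologicalClosure_coe, hdense]
      trivial
    exact closure_minimal hzero
      (isClosed_singleton.preimage (integralFunctional K hF).continuous) hφ
  refine ae_eq_zero_of_integral_contDiff_smul_eq_zero hF.locallyIntegrable fun g hg _ => ?_
  rw [← hall ⟨fun ω : K => ((g ω : ℝ) : ℂ),
    Complex.continuous_ofReal.comp (hg.continuous.comp continuous_subtype_val)⟩,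
    integralFunctional_apply hF hFK _ (fun ω => ((g ω : ℝ) : ℂ)) fun ω => rfl]
  simp

end FourierUniqueness

/-- Dilations preserve null sets; this carries almost everywhere statements between the frequencies
`ω` and `ω / 2π`. -/
theorem ae_comp_smul_iff {E : Type*} [NormedAddCommGroup E] [NormedSpace ℝ E]
    [FiniteDimensional ℝ E] [MeasurableSpace E] [BorelSpace E] (μ : Measure E) [μ.IsAddHaarMeasure]
    {r : ℝ} (hr : r ≠ 0) {p : E → Prop} : (∀ᵐ x ∂μ, p (r • x)) ↔ ∀ᵐ x ∂μ, p x := by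
  have key : ∀ {s : ℝ}, s ≠ 0 → ∀ {q : E → Prop}, (∀ᵐ x ∂μ, q x) → ∀ᵐ x ∂μ, q (s • x) := by
    intro s hs q hq
    rw [ae_iff] at hq ⊢
    have h := Measure.addHaar_preimage_smul μ hs {x | ¬ q x}
    rw [hq, mul_zero] at h
    exact h
  refine ⟨fun h => ?_, key hr⟩
  have := key (inv_ne_zero hr) h
  simpa [smul_smul, mul_inv_cancel₀ hr] using this

/-! ### Bandlimited fields and the Nyquist condition. -/

section Fields

variable {d n : ℕ}

theorem bandlimitedFields.sub {Ω : Set (EuclideanSpace ℝ (Fin d))}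
    {f g : EuclideanSpace ℝ (Fin d) → ℂ} (hf : f ∈ bandlimitedFields Ω)
    (hg : g ∈ bandlimitedFields Ω) : f - g ∈ bandlimitedFields Ω := by
  obtain ⟨hfc, hf2, hfF⟩ := hf
  obtain ⟨hgc, hg2, hgF⟩ := hg
  refine ⟨hfc.sub hgc, hf2.sub hg2, ?_⟩
  have hsub : (𝓕 ((hf2.sub hg2).toLp (f - g)) : Lp ℂ 2 volume) =
      𝓕 (hf2.toLp f) - 𝓕 (hg2.toLp g) := by
    rw [MemLp.toLp_sub]
    exact map_sub (Lp.fourierTransformₗᵢ _ ℂ) _ _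
  rw [hsub]
  have h := (ae_comp_smul_iff volume (inv_ne_zero Real.two_pi_pos.ne')).2
    (Lp.coeFn_sub (𝓕 (hf2.toLp f)) (𝓕 (hg2.toLp g)))
  filter_upwards [hfF, hgF, h] with ω h1 h2 h3 hω
  rw [h3, Pi.sub_apply, h1 hω, h2 hω, sub_zero]

theorem bandlimitedFields.zero_mem (Ω : Set (EuclideanSpace ℝ (Fin d))) :
    (0 : EuclideanSpace ℝ (Fin d) → ℂ) ∈ bandlimitedFields Ω := by
  refine ⟨continuous_zero, MemLp.zero, ?_⟩
  rw [MemLp.toLp_zero, FourierTransform.fourier_zero]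
  have h := (ae_comp_smul_iff volume (inv_ne_zero Real.two_pi_pos.ne')).2
    (Lp.coeFn_zero (E := ℂ) (p := 2) (μ := (volume : Measure (EuclideanSpace ℝ (Fin d)))))
  filter_upwards [h] with ω h1 _
  rw [h1, Pi.zero_apply]

/-- A Schwartz function whose Fourier transform is supported in `(2π)⁻¹ Ω` is bandlimited. -/
theorem SchwartzMap.mem_bandlimitedFields {Ω : Set (EuclideanSpace ℝ (Fin d))}
    (f : SchwartzMap (EuclideanSpace ℝ (Fin d)) ℂ)
    (hf : ∀ ω ∉ Ω, 𝓕 f ((2 * Real.pi)⁻¹ • ω) = 0) : ⇑f ∈ bandlimitedFields Ω := by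
  refine ⟨f.continuous, f.memLp 2 _, ?_⟩
  have h := (ae_comp_smul_iff volume (inv_ne_zero Real.two_pi_pos.ne')).2
    ((𝓕 f).coeFn_toLp 2 (volume : Measure (EuclideanSpace ℝ (Fin d))))
  filter_upwards [h] with ω h1 hω
  rw [show (f.memLp 2 volume).toLp f = f.toLp 2 from rfl, SchwartzMap.toLp_fourier_eq, h1, hf ω hω]

/-- A bandlimited field vanishing on a group `L` is zero if no two points of the band are
congruent modulo the dual of `L`. -/
theorem bandlimitedFields.eq_zero {Ω : Set (EuclideanSpace ℝ (Fin d))} (hΩ : IsCompact Ω)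
    {L : AddSubgroup (EuclideanSpace ℝ (Fin d))}
    (hsep : ∀ ω ∈ Ω, ∀ ω' ∈ Ω,
      (∀ x ∈ L, ∃ k : ℤ, inner ℝ (ω - ω') x = 2 * Real.pi * k) → ω = ω')
    {f : EuclideanSpace ℝ (Fin d) → ℂ} (hf : f ∈ bandlimitedFields Ω) (h0 : ∀ x ∈ L, f x = 0) :
    f = 0 := by
  obtain ⟨hfc, hf2, hfF⟩ := hf
  have h2pi : (2 * Real.pi) ≠ 0 := Real.two_pi_pos.ne'
  set F : Lp ℂ 2 (volume : Measure (EuclideanSpace ℝ (Fin d))) := 𝓕 (hf2.toLp f) with hF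
  let K : Set (EuclideanSpace ℝ (Fin d)) := (fun ω => (2 * Real.pi) • ω) ⁻¹' Ω
  have hK : IsCompact K := (Homeomorph.smulOfNeZero (2 * Real.pi) h2pi).isCompact_preimage.2 hΩ
  have hFK : ∀ᵐ ω, ω ∉ K → F ω = 0 := by
    have := (ae_comp_smul_iff volume h2pi).2 hfF
    simp only [inv_smul_smul₀ h2pi] at this
    exact this
  have hFint : Integrable F := by
    -- On a set of finite measure, `L²` is contained in `L¹`.
    have h1 : IntegrableOn F K := by
      have : IsFiniteMeasure (volume.restrict K) := ⟨by simpa using hK.measure_lt_top⟩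
      exact ((Lp.memLp F).restrict K).integrable one_le_two
    exact h1.integrable_of_ae_notMem_eq_zero hFK
  have hinv := hfc.eq_fourierInv_of_memLp hf2 hFint
  have hF0 : F =ᵐ[volume] 0 := by
    refine ae_eq_zero_of_fourierInv_eq_zero hK hFint hFK L ?_ ?_
    · intro ξ hξ ξ' hξ' h
      refine smul_right_injective _ h2pi (hsep _ hξ _ hξ' fun x hx => ?_)
      obtain ⟨k, hk⟩ := (Real.fourierChar_eq_one_iff _).1 (h x hx)
      exact ⟨k, by rw [← smul_sub, real_inner_smul_left, hk]⟩
    · intro x hx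
      rw [← hinv, h0 x hx]
  rw [hinv]
  ext x
  rw [Real.fourierInv_congr_ae hF0]
  simp [Real.fourierInv_eq]

theorem inner_uniformSet {v : Fin (n + 1) → EuclideanSpace ℝ (Fin (n + 1))}
    {u : Fin n → EuclideanSpace ℝ (Fin (n + 1))}
    (hu : ∀ i j, inner ℝ (u i) (v j) = if i.castSucc = j then 2 * Real.pi else 0)
    (i : Fin n) (m : Fin n → ℤ) (t : ℝ) :
    inner ℝ (u i) (uniformSet v m t) = 2 * Real.pi * m i := by
  change inner ℝ (u i) (∑ i : Fin n, (m i : ℝ) • v i.castSucc + t • v (Fin.last n)) = _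
  rw [inner_add_right, inner_sum, real_inner_smul_right, hu, if_neg (Fin.castSucc_ne_last i)]
  simp [real_inner_smul_right, hu, mul_comm]

/-- If a frequency of half the dual lattice lies in the interior of the band, some nonzero
bandlimited field vanishes on all the lines. -/
theorem exists_bandlimitedField_vanishing_on_uniformSet
    {v : Fin (n + 1) → EuclideanSpace ℝ (Fin (n + 1))}
    {u : Fin n → EuclideanSpace ℝ (Fin (n + 1))}
    (hu : ∀ i j, inner ℝ (u i) (v j) = if i.castSucc = j then 2 * Real.pi else 0)
    {Ω : Set (EuclideanSpace ℝ (Fin (n + 1)))} (hsymm : ∀ ω ∈ Ω, -ω ∈ Ω)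
    {m : Fin n → ℤ} (hm : m ≠ 0) (hmΩ : (1 / 2 : ℝ) • ∑ i, (m i : ℝ) • u i ∈ interior Ω) :
    ∃ f ∈ bandlimitedFields Ω, f ≠ 0 ∧ ∀ k t, f (uniformSet v k t) = 0 := by
  have hpi := Real.two_pi_pos
  set w := (1 / 2 : ℝ) • ∑ i, (m i : ℝ) • u i with hw
  have hwv : ∀ k t, inner ℝ w (uniformSet v k t) = Real.pi * (∑ i, m i * k i : ℤ) := by
    intro k t
    simp only [hw, real_inner_smul_left, sum_inner, inner_uniformSet hu]
    push_cast
    rw [Finset.mul_sum, Finset.mul_sum]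
    exact Finset.sum_congr rfl fun i _ => by ring
  have hw0 : w ≠ 0 := by
    intro h0
    refine hm (funext fun i => ?_)
    -- Pairing `w` with a point of the `i`-th generator line reads off `π m_i`.
    have h := hwv (Pi.single i 1) 0
    rw [h0, inner_zero_left] at h
    have h' : (∑ j, m j * (Pi.single i 1 : Fin n → ℤ) j : ℤ) = m i := by
      simp [Pi.single_apply]
    rw [h'] at h
    have := mul_eq_zero.1 h.symm
    simpa [Real.pi_ne_zero] using this
  obtain ⟨ε, hε, hball⟩ := Metric.isOpen_iff.1 isOpen_interior w hmΩ
  replace hball := hball.trans interior_subset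
  -- The bound `ε / 2π` keeps both bumps inside the rescaled band; `‖w‖ / 2π` makes the bump at
  -- `-w'` vanish at `w'`, so that `G w' = 1`.
  set δ := min ε ‖w‖ / (2 * Real.pi) with hδ
  have hδ0 : 0 < δ := div_pos (lt_min hε (norm_pos_iff.2 hw0)) hpi
  let b : ContDiffBump (0 : EuclideanSpace ℝ (Fin (n + 1))) := ⟨δ / 2, δ, by positivity, by linarith⟩
  set w' := (2 * Real.pi)⁻¹ • w with hw'
  have hbs : ∀ x, δ ≤ ‖x‖ → b x = 0 := fun x hx => b.zero_of_le_dist (by simpa using hx)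
  let B : SchwartzMap (EuclideanSpace ℝ (Fin (n + 1))) ℂ :=
    (b.hasCompactSupport.comp_left (g := Complex.ofReal) rfl).toSchwartzMap
    (Complex.ofRealCLM.contDiff.comp b.contDiff)
  have hB : ∀ x, B x = b x := fun x => rfl
  let G : SchwartzMap (EuclideanSpace ℝ (Fin (n + 1))) ℂ :=
    SchwartzMap.compSubConstCLM ℂ w' B - SchwartzMap.compSubConstCLM ℂ (-w') B
  have hG : ∀ ξ, G ξ = b (ξ - w') - b (ξ + w') := fun ξ => by simp [G, hB]
  have hfar : ∀ ω ∉ Ω, δ ≤ ‖(2 * Real.pi)⁻¹ • ω - w'‖ := by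
    intro ω hω
    rw [hw', ← smul_sub, norm_smul, norm_inv, Real.norm_of_nonneg hpi.le, hδ, div_eq_inv_mul]
    gcongr
    refine (min_le_left _ _).trans (not_lt.1 fun h => hω (hball ?_))
    rwa [mem_ball_iff_norm]
  refine ⟨(𝓕⁻ G : SchwartzMap _ ℂ), SchwartzMap.mem_bandlimitedFields _ fun ω hω => ?_, fun h => ?_, fun k t => ?_⟩
  · rw [FourierTransform.fourier_fourierInv_eq, hG, hbs _ (hfar ω hω), hbs]
    · simp
    · have := hfar (-ω) fun h => hω (by simpa using hsymm _ h)
      rwa [smul_neg, ← neg_add', norm_neg] at this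
  · have h1 : 𝓕⁻ G = 0 := DFunLike.coe_injective h
    have h2 : G = 0 := by
      rw [← FourierTransform.fourier_fourierInv_eq
        (F := SchwartzMap (EuclideanSpace ℝ (Fin (n + 1))) ℂ) G, h1, FourierTransform.fourier_zero]
    have h3 := hG w'
    rw [h2, sub_self, b.one_of_mem_closedBall (Metric.mem_closedBall_self b.rIn_pos.le), hbs] at h3
    · simp at h3
    · rw [← two_smul ℝ, hw', norm_smul, norm_smul, norm_inv, Real.norm_of_nonneg hpi.le, hδ,
        div_eq_inv_mul, Real.norm_of_nonneg two_pos.le]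
      have h4 : (2 * Real.pi)⁻¹ * min ε ‖w‖ ≤ (2 * Real.pi)⁻¹ * ‖w‖ := by
        gcongr
        exact min_le_right _ _
      have h5 : 0 ≤ (2 * Real.pi)⁻¹ * ‖w‖ := by positivity
      linarith
  · rw [SchwartzMap.fourierInv_coe, Real.fourierInv_eq]
    -- Points of the lines pair with `2w'` to integers. Translation by `2w'` thus fixes the
    -- character and carries one bump to the other, and the two integrals cancel.
    have hchar : ∀ ξ, Real.fourierChar (inner ℝ (ξ + (2:ℝ) • w') (uniformSet v k t)) =
        Real.fourierChar (inner ℝ ξ (uniformSet v k t)) := by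
      intro ξ
      rw [inner_add_left, AddChar.map_add_eq_mul, (Real.fourierChar_eq_one_iff (inner ℝ ((2 : ℝ) • w') _)).2,
        mul_one]
      refine ⟨∑ i, m i * k i, ?_⟩
      rw [hw', smul_smul, real_inner_smul_left, hwv]
      field_simp
    have hint : ∀ c : EuclideanSpace ℝ (Fin (n + 1)), Integrable fun ξ =>
        Real.fourierChar (inner ℝ ξ (uniformSet v k t)) • ((b (ξ + c) : ℝ) : ℂ) := by
      intro c
      have hBc := (SchwartzMap.compSubConstCLM ℂ (-c) B).integrable (μ := volume)
      refine ((VectorFourier.fourierIntegral_convergent_iff Real.continuous_fourierChar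
        (L := -innerₗ _) (by exact continuous_inner.neg) (uniformSet v k t)).2 hBc).congr
        (ae_of_all _ fun ξ => ?_)
      simp [hB]
    have hsplit : ∀ ξ, Real.fourierChar (inner ℝ ξ (uniformSet v k t)) • G ξ =
        Real.fourierChar (inner ℝ ξ (uniformSet v k t)) • ((b (ξ + -w') : ℝ) : ℂ) -
        Real.fourierChar (inner ℝ ξ (uniformSet v k t)) • ((b (ξ + w') : ℝ) : ℂ) := by
      intro ξ
      rw [hG, smul_sub, sub_eq_add_neg ξ]
    simp_rw [hsplit]
    rw [integral_sub (hint _) (hint _), sub_eq_zero,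
      ← integral_add_right_eq_self _ ((2 : ℝ) • w')]
    refine integral_congr_ae (ae_of_all _ fun ξ => ?_)
    simp only [hchar]
    rw [add_assoc, two_smul, add_neg_cancel_right]

/-- Differences of lattice points are lattice points, so isolation of `0` gives a uniform gap. -/
theorem uniformlyDiscrete_span_int (b : Module.Basis (Fin d) ℝ (EuclideanSpace ℝ (Fin d))) :
    UniformlyDiscrete (Submodule.span ℤ (range b) : Set (EuclideanSpace ℝ (Fin d))) := by
  obtain ⟨r, hr, hball⟩ := Metric.exists_ball_inter_eq_singleton_of_mem_discrete
    (s := (Submodule.span ℤ (range b) : Set (EuclideanSpace ℝ (Fin d))))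
    (isDiscrete_iff_discreteTopology.2
      (inferInstanceAs (DiscreteTopology (Submodule.span ℤ (range b))))) (zero_mem _)
  refine ⟨r / 2, half_pos hr, fun x hx y hy hxy => ?_⟩
  by_contra! hle
  have : x - y ∈ Metric.ball 0 r ∩ (Submodule.span ℤ (range b) : Set (EuclideanSpace ℝ (Fin d))) :=
    ⟨by rw [mem_ball_zero_iff]; linarith, sub_mem hx hy⟩
  rw [hball] at this
  exact hxy (sub_eq_zero.1 this)

theorem norm_last_eq_one {v : Fin (n + 1) → EuclideanSpace ℝ (Fin (n + 1))}
    (hvd : ∀ i, inner ℝ (v i) (v (Fin.last n)) = if i = Fin.last n then (1 : ℝ) else 0)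
    : ‖v (Fin.last n)‖ = 1 := by
  have := hvd (Fin.last n)
  rw [if_pos rfl, real_inner_self_eq_norm_sq] at this
  nlinarith [norm_nonneg (v (Fin.last n))]

/-- The uniform set of lines satisfies the Nyquist condition if half the nonzero dual lattice
frequencies avoid the band. -/
theorem nyquistCondition_uniformSet
    {v : Fin (n + 1) → EuclideanSpace ℝ (Fin (n + 1))} (hv : LinearIndependent ℝ v)
    (hvd : ∀ i, inner ℝ (v i) (v (Fin.last n)) = if i = Fin.last n then (1 : ℝ) else 0)
    {u : Fin n → EuclideanSpace ℝ (Fin (n + 1))}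
    (hu : ∀ i j, inner ℝ (u i) (v j) = if i.castSucc = j then 2 * Real.pi else 0)
    {Ω : Set (EuclideanSpace ℝ (Fin (n + 1)))}
    (hcompact : IsCompact Ω) (hconvex : Convex ℝ Ω) (hsymm : ∀ ω ∈ Ω, -ω ∈ Ω)
    (hΩ : ∀ m : Fin n → ℤ, m ≠ 0 → (1 / 2 : ℝ) • ∑ i, (m i : ℝ) • u i ∉ Ω) :
    NyquistCondition Ω (uniformSet v) := by
  have hpi := Real.two_pi_pos
  obtain ⟨R, hR0, hR⟩ := hcompact.isBounded.exists_pos_norm_le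
  -- Sampling step along the lines: the dual spacing `2π(R + 1)` exceeds `2R`, the bound on
  -- differences in the band.
  let c : Fin (n + 1) → ℝ := Fin.snoc (fun _ => 1) (R + 1)⁻¹
  have hc : ∀ i, c i ≠ 0 := by
    intro i
    induction i using Fin.lastCases <;> simp [c]; positivity
  let b₀ := basisOfLinearIndependentOfCardEqFinrank hv (by simp)
  let b := b₀.isUnitSMul (w := c) fun i => (hc i).isUnit
  have hb : ∀ i, b i = c i • v i := fun i => by
    rw [Module.Basis.isUnitSMul_apply, coe_basisOfLinearIndependentOfCardEqFinrank]
  let L := Submodule.span ℤ (range b)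
  have hvL : ∀ i, c i • v i ∈ L := fun i => hb i ▸ Submodule.subset_span ⟨i, rfl⟩
  refine ⟨L, fun x hx => ?_, uniformlyDiscrete_span_int b, fun f hf g hg hfg => ?_⟩
  · obtain ⟨k, rfl⟩ := (Submodule.mem_span_range_iff_exists_fun ℤ).1 hx
    refine ⟨fun i => k i.castSucc, k (Fin.last n) * (R + 1)⁻¹, ?_⟩
    change ∑ i : Fin n, (k i.castSucc : ℝ) • v i.castSucc + _ • v (Fin.last n) = _
    rw [Fin.sum_univ_castSucc]
    simp [hb, c, ← Int.cast_smul_eq_zsmul ℝ, mul_smul]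
  refine sub_eq_zero.1 (bandlimitedFields.eq_zero hcompact (L := L.toAddSubgroup) ?_
    (bandlimitedFields.sub hf hg) fun x hx => sub_eq_zero.2 (hfg x hx))
  intro ω hω ω' hω' h
  choose k hk using fun i => h _ (hvL i)
  have hnorm : ‖ω - ω'‖ ≤ 2 * R :=
    (norm_sub_le _ _).trans (by linarith [hR ω hω, hR ω' hω'])
  have hvn := norm_last_eq_one hvd
  have hlast : inner ℝ (ω - ω') (v (Fin.last n)) = 0 := by
    have h1 := hk (Fin.last n)
    rw [real_inner_smul_right] at h1
    simp only [c, Fin.snoc_last] at h1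
    have h2 : inner ℝ (ω - ω') (v (Fin.last n)) = 2 * Real.pi * (R + 1) * k (Fin.last n) := by
      field_simp at h1
      linarith
    have h3 := (abs_real_inner_le_norm (ω - ω') (v (Fin.last n))).trans_eq (by rw [hvn, mul_one])
    have h4 : k (Fin.last n) = 0 := by
      by_contra hne
      have h5 : (1 : ℝ) ≤ |(k (Fin.last n) : ℝ)| := by
        exact_mod_cast Int.one_le_abs hne
      rw [h2, abs_mul, abs_of_pos (by positivity)] at h3
      have h6 : 2 * Real.pi * (R + 1) * 1 ≤ 2 * Real.pi * (R + 1) * |(k (Fin.last n) : ℝ)| := by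
        gcongr
      nlinarith [Real.pi_gt_three]
    rw [h2, h4, Int.cast_zero, mul_zero]
  have hdiff : ω - ω' = ∑ i, (k i.castSucc : ℝ) • u i := by
    refine InnerProductSpace.ext_inner_right_basis b₀ fun j => ?_
    rw [coe_basisOfLinearIndependentOfCardEqFinrank, sum_inner]
    simp only [real_inner_smul_left, hu]
    induction j using Fin.lastCases with
    | last => simp [hlast, Fin.castSucc_ne_last]
    | cast j =>
      have h1 := hk j.castSucc
      simp only [c, Fin.snoc_castSucc, one_smul] at h1
      simp [h1, mul_comm]
  by_contra hne
  have hk0 : (fun i : Fin n => k i.castSucc) ≠ 0 := by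
    intro h0
    refine hne (sub_eq_zero.1 ?_)
    rw [hdiff]
    exact Finset.sum_eq_zero fun i _ => by simp [congrFun h0 i]
  refine hΩ _ hk0 ?_
  rw [← hdiff]
  -- The midpoint of `ω` and `-ω'` is half the difference.
  have := hconvex hω (hsymm _ hω') (a := 1 / 2) (b := 1 / 2) (by norm_num) (by norm_num)
    (by norm_num)
  rwa [smul_neg, ← sub_eq_add_neg, ← smul_sub] at this

end Fields

/-! ### A Gray code through the integer box. -/

section Snake

/-- The triangle wave that runs back and forth through `-K, …, K`. -/
def triangleWave (K j : ℕ) : ℤ :=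
  if j / (2 * K + 1) % 2 = 0 then (j % (2 * K + 1) : ℕ) - (K : ℤ)
  else (K : ℤ) - (j % (2 * K + 1) : ℕ)

/-- A path through the box `{-K, …, K}ⁿ` that changes each coordinate by at most one in a step
(the reflected mixed radix Gray code). -/
def snakePath (K : ℕ) : (n : ℕ) → ℕ → Fin n → ℤ
  | 0, _ => Fin.elim0
  | n + 1, j => Fin.cons (triangleWave K j) (snakePath K n (j / (2 * K + 1)))

theorem triangleWave_abs_le (K j : ℕ) : |triangleWave K j| ≤ K := by
  have : j % (2 * K + 1) < 2 * K + 1 := Nat.mod_lt _ (by omega)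
  unfold triangleWave
  rw [abs_le]
  split_ifs <;> omega

theorem snakePath_abs_le (K n j : ℕ) (i : Fin n) : |snakePath K n j i| ≤ K := by
  induction n generalizing j with
  | zero => exact i.elim0
  | succ n ih =>
    induction i using Fin.cases with
    | zero => exact triangleWave_abs_le K j
    | succ i => exact ih _ i

theorem succ_div_mod_cases (M j : ℕ) (hM : 0 < M) :
    ((j + 1) / M = j / M ∧ (j + 1) % M = j % M + 1) ∨
      ((j + 1) / M = j / M + 1 ∧ (j + 1) % M = 0 ∧ j % M = M - 1) := by
  have h1 := Nat.div_add_mod j M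
  have h2 := Nat.mod_lt j hM
  rcases Nat.lt_or_ge (j % M + 1) M with h | h
  · left
    have : j + 1 = j % M + 1 + M * (j / M) := by omega
    constructor
    · rw [this, Nat.add_mul_div_left _ _ hM, Nat.div_eq_of_lt h, zero_add]
    · rw [this, Nat.add_mul_mod_self_left, Nat.mod_eq_of_lt h]
  · right
    have : j + 1 = M * (j / M + 1) := by rw [mul_add]; omega
    refine ⟨?_, ?_, by omega⟩
    · rw [this, Nat.mul_div_cancel_left _ hM]
    · rw [this, Nat.mul_mod_right]

/-- When a sweep ends the direction reverses, so the wave repeats its extreme value instead of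
jumping back. -/
theorem triangleWave_step (K j : ℕ) : |triangleWave K (j + 1) - triangleWave K j| ≤ 1 := by
  rcases succ_div_mod_cases (2 * K + 1) j (by omega) with ⟨h1, h2⟩ | ⟨h1, h2, h3⟩
  · unfold triangleWave
    rw [h1, h2, abs_le]
    split_ifs <;> omega
  · unfold triangleWave
    rw [h1, h2, h3, abs_le]
    split_ifs <;> omega

theorem snakePath_step (K n j : ℕ) (i : Fin n) :
    |snakePath K n (j + 1) i - snakePath K n j i| ≤ 1 := by
  induction n generalizing j with
  | zero => exact i.elim0
  | succ n ih =>
    induction i using Fin.cases with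
    | zero => exact triangleWave_step K j
    | succ i =>
      simp only [snakePath, Fin.cons_succ]
      rcases succ_div_mod_cases (2 * K + 1) j (by omega) with ⟨h1, -⟩ | ⟨h1, -⟩
      · simp [h1]
      · rw [h1]
        exact ih _ i

theorem exists_snakePath_eq (K n : ℕ) (m : Fin n → ℤ) (hm : ∀ i, |m i| ≤ K) :
    ∃ j < (2 * K + 1) ^ n, snakePath K n j = m := by
  induction n with
  | zero => exact ⟨0, by simp, Subsingleton.elim _ _⟩
  | succ n ih =>
    obtain ⟨j, hj, hjm⟩ := ih (Fin.tail m) fun i => hm i.succ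
    have h0 := abs_le.1 (hm 0)
    -- The parity of the higher index `j` decides the direction of the sweep, hence which digit
    -- gives `m 0`.
    obtain ⟨r, hr, hrm⟩ : ∃ r < 2 * K + 1,
        (if j % 2 = 0 then (r : ℤ) - K else (K : ℤ) - r) = m 0 := by
      by_cases h : j % 2 = 0
      · exact ⟨(m 0 + K).toNat, by omega, by rw [if_pos h]; omega⟩
      · exact ⟨(K - m 0).toNat, by omega, by rw [if_neg h]; omega⟩
    refine ⟨r + (2 * K + 1) * j, ?_, ?_⟩
    · calc r + (2 * K + 1) * j < (2 * K + 1) * (j + 1) := by rw [mul_add]; omega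
        _ ≤ (2 * K + 1) * (2 * K + 1) ^ n := by gcongr; omega
        _ = (2 * K + 1) ^ (n + 1) := (pow_succ' _ _).symm
    · have hdiv : (r + (2 * K + 1) * j) / (2 * K + 1) = j := by
        rw [Nat.add_mul_div_left _ _ (by omega), Nat.div_eq_of_lt hr, zero_add]
      have hmod : (r + (2 * K + 1) * j) % (2 * K + 1) = r := by
        rw [Nat.add_mul_mod_self_left, Nat.mod_eq_of_lt hr]
      simp only [snakePath, triangleWave, hdiv, hmod, hrm, hjm]
      exact Fin.cons_self_tail m

/-- The path covers the box in as many indices as the box has points, so no point is repeated. -/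
theorem snakePath_injOn (K n : ℕ) :
    InjOn (snakePath K n) (Finset.range ((2 * K + 1) ^ n) : Set ℕ) := by
  rw [← Finset.card_image_iff]
  refine le_antisymm Finset.card_image_le ?_
  have hbox : (Fintype.piFinset fun _ : Fin n => Finset.Icc (-K : ℤ) K).card =
      (2 * K + 1) ^ n := by
    rw [Fintype.card_piFinset_const, Int.card_Icc]
    congr 1
    omega
  rw [Finset.card_range]
  refine hbox.symm.trans_le ?_
  refine Finset.card_le_card fun m hm => ?_
  obtain ⟨j, hj, rfl⟩ := exists_snakePath_eq K n m fun i =>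
    abs_le.2 (Finset.mem_Icc.1 (Fintype.mem_piFinset.1 hm i))
  exact Finset.mem_image_of_mem _ (Finset.mem_range.2 hj)

end Snake

/-! ### Polygonal curves and their variation. -/

section Polygon

variable {E : Type*} [NormedAddCommGroup E]

theorem eVariationOn.add_le {α : Type*} [LinearOrder α] (f g : α → E) (s : Set α) :
    eVariationOn (f + g) s ≤ eVariationOn f s + eVariationOn g s := by
  refine iSup_le fun p => ?_
  refine (Finset.sum_le_sum fun i _ => edist_add_add_le _ _ _ _).trans ?_
  rw [Finset.sum_add_distrib]
  exact add_le_add (eVariationOn.sum_le p.2.2.1 p.2.2.2) (eVariationOn.sum_le p.2.2.1 p.2.2.2)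

variable [NormedSpace ℝ E]

theorem eVariationOn_monotone_smul_le (φ : ℝ → ℝ) (hφ : Monotone φ) (h01 : ∀ t, φ t ∈ Icc 0 1)
    (c : E) : eVariationOn (fun t => φ t • c) univ ≤ ‖c‖ₑ := by
  have h1 : eVariationOn φ univ ≤ 1 := by
    rw [eVariationOn.eq_biSup_inter_Icc]
    refine iSup₂_le fun p _ => ?_
    rw [(hφ.monotoneOn univ).eVariationOn_eq (mem_univ _) (mem_univ _),
      ENNReal.ofReal_le_one]
    linarith [(h01 p.1).1, (h01 p.2).2]
  have h2 : LipschitzOnWith ‖c‖₊ (fun r : ℝ => r • c) univ := by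
    refine (LipschitzWith.of_dist_le_mul fun r r' => ?_).lipschitzOnWith
    rw [dist_eq_norm, ← sub_smul, norm_smul, dist_eq_norm, mul_comm, coe_nnnorm]
  refine (h2.comp_eVariationOn_le (mapsTo_univ _ _)).trans ?_
  calc (‖c‖₊ : ℝ≥0∞) * eVariationOn φ univ ≤ ‖c‖₊ * 1 := by gcongr
    _ = ‖c‖ₑ := mul_one _

/-- The polygonal curve through the points `P 0, …, P N`. -/
theorem exists_polygonal_curve (P : ℕ → E) (N : ℕ) :
    ∃ γ : C(ℝ, E), (∀ j < N, segment ℝ (P j) (P (j + 1)) ⊆ range γ) ∧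
      eVariationOn γ univ ≤ ∑ j ∈ Finset.range N, edist (P j) (P (j + 1)) := by
  -- Being constant after time `N` lets the induction append an edge by adding a term that is zero
  -- up to `N`.
  suffices h : ∃ γ : C(ℝ, E), (∀ t : ℝ, N ≤ t → γ t = P N) ∧
      (∀ j < N, segment ℝ (P j) (P (j + 1)) ⊆ γ '' Iic (N : ℝ)) ∧
      eVariationOn γ univ ≤ ∑ j ∈ Finset.range N, edist (P j) (P (j + 1)) by
    obtain ⟨γ, -, h1, h2⟩ := h
    exact ⟨γ, fun j hj => (h1 j hj).trans (image_subset_range _ _), h2⟩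
  induction N with
  | zero =>
    refine ⟨ContinuousMap.const ℝ (P 0), fun _ _ => rfl, by simp, ?_⟩
    rw [eVariationOn.constant_on]
    · simp
    · rintro - ⟨s, -, rfl⟩ - ⟨t, -, rfl⟩
      rfl
  | succ N ih =>
    obtain ⟨γ, hend, hseg, hvar⟩ := ih
    let φ : ℝ → ℝ := fun t => max 0 (min 1 (t - N))
    have hφc : Continuous φ := by fun_prop
    have hφm : Monotone φ := fun s t hst => by
      simp only [φ]
      gcongr
    have hφ0 : ∀ t ≤ (N : ℝ), φ t = 0 := fun t ht =>
      max_eq_left ((min_le_right _ _).trans (by linarith))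
    have hφI : ∀ s ∈ Icc (0 : ℝ) 1, φ (N + s) = s := fun s hs => by
      simp only [φ, add_sub_cancel_left]
      rw [min_eq_right hs.2, max_eq_right hs.1]
    have hφ1 : ∀ t, (N + 1 : ℝ) ≤ t → φ t = 1 := fun t ht => by
      simp only [φ]
      rw [min_eq_left (by linarith), max_eq_right zero_le_one]
    refine ⟨γ + ⟨fun t => φ t • (P (N + 1) - P N), by fun_prop⟩, fun t ht => ?_, fun j hj => ?_, ?_⟩
    · push_cast at ht
      simp [hend t (by linarith), hφ1 t ht]
    · rcases Nat.lt_succ_iff_lt_or_eq.1 hj with hj | rfl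
      · intro z hz
        obtain ⟨t, ht, rfl⟩ := hseg j hj hz
        refine ⟨t, ?_, by simp [hφ0 t ht]⟩
        simp only [mem_Iic] at ht ⊢
        push_cast
        linarith
      · rw [segment_eq_image']
        rintro - ⟨s, hs, rfl⟩
        refine ⟨j + s, ?_, ?_⟩
        · simp only [mem_Iic]
          push_cast
          linarith [hs.2]
        · simp [hend (j + s) (by linarith [hs.1]), hφI s hs]
    · rw [Finset.sum_range_succ]
      refine (eVariationOn.add_le γ (fun t => φ t • (P (N + 1) - P N)) univ).trans ?_
      refine add_le_add hvar ((eVariationOn_monotone_smul_le φ hφm (fun t => ⟨le_max_left _ _, ?_⟩)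
        _).trans_eq ?_)
      · exact max_le zero_le_one (min_le_left _ _)
      · rw [← edist_eq_enorm_sub, edist_comm]

end Polygon

/-- Controls chord lengths even near tangency, where the square root is not Lipschitz. -/
theorem Real.abs_sqrt_sub_sqrt_le (x y : ℝ) : |√x - √y| ≤ √|x - y| := by
  have key : ∀ x y : ℝ, √x - √y ≤ √|x - y| := fun x y => by
    have h1 : x ≤ |x - y| + y := by linarith [le_abs_self (x - y)]
    rcases le_total 0 y with hy | hy
    · rw [sub_le_iff_le_add]
      refine Real.sqrt_le_iff.2 ⟨by positivity, h1.trans ?_⟩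
      rw [add_sq, Real.sq_sqrt (abs_nonneg _), Real.sq_sqrt hy]
      have : 0 ≤ 2 * √|x - y| * √y := by positivity
      linarith
    · rw [Real.sqrt_eq_zero_of_nonpos hy, sub_zero]
      exact Real.sqrt_le_sqrt (by linarith)
  rw [abs_le]
  constructor
  · have := key y x
    rw [abs_sub_comm] at this
    linarith
  · exact key x y

theorem isLittleO_add_one_pow_mul_sqrt (C : ℝ) (n : ℕ) :
    (fun a : ℝ => C * ((a + 1) ^ n * √(a + 1))) =o[atTop] fun a : ℝ => a ^ (n + 1) := by
  have h1 : (fun a : ℝ => a + 1) =O[atTop] fun a : ℝ => a :=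
    (isBigO_refl _ _).add (isLittleO_const_id_atTop (1 : ℝ)).isBigO
  have h2 : (fun a : ℝ => √(a + 1)) =o[atTop] fun a : ℝ => a := by
    have h3 : (fun a : ℝ => √a) =o[atTop] fun a : ℝ => a := by
      have h4 : (fun _ : ℝ => (1 : ℝ)) =o[atTop] fun a : ℝ => √a := by
        rw [isLittleO_one_left_iff]
        exact tendsto_norm_atTop_atTop.comp Real.tendsto_sqrt_atTop
      refine ((isBigO_refl (fun a : ℝ => √a) atTop).mul_isLittleO h4).congr' ?_ ?_
      · exact Eventually.of_forall fun a => mul_one _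
      · filter_upwards [eventually_ge_atTop 0] with a ha using Real.mul_self_sqrt ha
    exact (h3.comp_tendsto (tendsto_atTop_add_const_right atTop (1 : ℝ) tendsto_id)).trans_isBigO h1
  simp only [pow_succ]
  exact ((h1.pow n).mul_isLittleO h2).const_mul_left C

/-- Separates the edges along chords (even) from the crossings (odd). -/
theorem Finset.sum_range_two_mul {M : Type*} [AddCommMonoid M] (f : ℕ → M) (N : ℕ) :
    ∑ k ∈ Finset.range (2 * N), f k = ∑ j ∈ Finset.range N, (f (2 * j) + f (2 * j + 1)) := by
  induction N with
  | zero => simp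
  | succ N ih => rw [Finset.sum_range_succ, ← ih, mul_add, mul_one, Finset.sum_range_succ,
      Finset.sum_range_succ, add_assoc]

/-! ### Chords in a ball and the length of the snake. -/

section Chords

variable {n : ℕ} {v : Fin (n + 1) → EuclideanSpace ℝ (Fin (n + 1))}

/-- The component orthogonal to the lines of the vector from `x` to the line `m`. -/
noncomputable def lineOffset (v : Fin (n + 1) → EuclideanSpace ℝ (Fin (n + 1)))
    (x : EuclideanSpace ℝ (Fin (n + 1))) (m : Fin n → ℤ) : EuclideanSpace ℝ (Fin (n + 1)) :=
  ∑ i : Fin n, (m i : ℝ) • v i.castSucc - (x - inner ℝ x (v (Fin.last n)) • v (Fin.last n))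

/-- Half the length of the chord that the line `m` cuts out of the ball of radius `a` at `x`. -/
noncomputable def halfChord (v : Fin (n + 1) → EuclideanSpace ℝ (Fin (n + 1)))
    (x : EuclideanSpace ℝ (Fin (n + 1))) (a : ℝ) (m : Fin n → ℤ) : ℝ :=
  √(a ^ 2 - ‖lineOffset v x m‖ ^ 2)

theorem uniformSet_sub_eq (x : EuclideanSpace ℝ (Fin (n + 1))) (m : Fin n → ℤ) (t : ℝ) :
    uniformSet v m t - x =
      lineOffset v x m + (t - inner ℝ x (v (Fin.last n))) • v (Fin.last n) := by
  change ∑ i : Fin n, (m i : ℝ) • v i.castSucc + t • v (Fin.last n) - x = _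
  rw [lineOffset, sub_smul]
  abel

theorem uniformSet_mem_segment (m : Fin n → ℤ) {s t r : ℝ} (hr : r ∈ segment ℝ s t) :
    uniformSet v m r ∈ segment ℝ (uniformSet v m s) (uniformSet v m t) := by
  obtain ⟨α, β, hα, hβ, hαβ, rfl⟩ := hr
  refine ⟨α, β, hα, hβ, hαβ, ?_⟩
  change α • (∑ i : Fin n, (m i : ℝ) • v i.castSucc + s • v (Fin.last n)) +
    β • (∑ i : Fin n, (m i : ℝ) • v i.castSucc + t • v (Fin.last n)) =
    ∑ i : Fin n, (m i : ℝ) • v i.castSucc + (α • s + β • t) • v (Fin.last n)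
  obtain rfl := eq_sub_of_add_eq hαβ
  simp only [smul_eq_mul]
  module

theorem norm_uniformSet_sub_sq
    (hvd : ∀ i, inner ℝ (v i) (v (Fin.last n)) = if i = Fin.last n then (1 : ℝ) else 0)
    (x : EuclideanSpace ℝ (Fin (n + 1))) (m : Fin n → ℤ) (t : ℝ) :
    ‖uniformSet v m t - x‖ ^ 2 =
      ‖lineOffset v x m‖ ^ 2 + (t - inner ℝ x (v (Fin.last n))) ^ 2 := by
  have horth : inner ℝ (lineOffset v x m) (v (Fin.last n)) = 0 := by
    rw [lineOffset, inner_sub_left, inner_sub_left, sum_inner, real_inner_smul_left,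
      hvd (Fin.last n)]
    simp [real_inner_smul_left, hvd, Fin.castSucc_ne_last]
  rw [uniformSet_sub_eq, norm_add_sq_real, real_inner_smul_right, horth, norm_smul,
    norm_last_eq_one hvd]
  simp

theorem norm_uniformSet_sub_le_iff
    (hvd : ∀ i, inner ℝ (v i) (v (Fin.last n)) = if i = Fin.last n then (1 : ℝ) else 0)
    {x : EuclideanSpace ℝ (Fin (n + 1))} {a : ℝ} (ha : 0 ≤ a)
    (m : Fin n → ℤ) (t : ℝ) : ‖uniformSet v m t - x‖ ≤ a ↔
      (t - inner ℝ x (v (Fin.last n))) ^ 2 ≤ a ^ 2 - ‖lineOffset v x m‖ ^ 2 := by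
  rw [← sq_le_sq₀ (norm_nonneg _) ha, norm_uniformSet_sub_sq hvd]
  constructor <;> intro h <;> linarith

theorem sum_halfChord_le_arcLengthInBall
    (hvd : ∀ i, inner ℝ (v i) (v (Fin.last n)) = if i = Fin.last n then (1 : ℝ) else 0)
    (x : EuclideanSpace ℝ (Fin (n + 1))) {a : ℝ} (ha : 0 ≤ a) :
    ∑' m, ENNReal.ofReal (2 * halfChord v x a m) ≤ arcLengthInBall (uniformSet v) a x := by
  refine ENNReal.tsum_le_tsum fun m => ?_
  have hderiv : ∀ t, deriv (uniformSet v m) t = v (Fin.last n) := by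
    intro t
    have h : HasDerivAt (fun t : ℝ => ∑ i : Fin n, (m i : ℝ) • v i.castSucc + t • v (Fin.last n))
        ((1 : ℝ) • v (Fin.last n)) t := ((hasDerivAt_id t).smul_const _).const_add _
    rw [one_smul] at h
    exact h.deriv
  simp only [hderiv, lintegral_const, Measure.restrict_apply_univ, ← ofReal_norm,
    norm_last_eq_one hvd, ENNReal.ofReal_one, one_mul]
  set c := inner ℝ x (v (Fin.last n)) with hc
  -- A line missing the ball has a negative radicand, so its half chord is `0` by convention.
  rcases le_or_gt (halfChord v x a m) 0 with h0 | h0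
  · rw [ENNReal.ofReal_of_nonpos (by linarith)]
    exact bot_le
  · have hsub : Icc (c - halfChord v x a m) (c + halfChord v x a m) ⊆
        {t | ‖uniformSet v m t - x‖ ≤ a} := by
      intro t ht
      rw [mem_ofPred_eq, norm_uniformSet_sub_le_iff hvd ha,
        ← Real.sq_sqrt (Real.sqrt_pos.1 h0).le]
      exact sq_le_sq' (by simp only [halfChord] at ht; linarith [ht.1])
        (by simp only [halfChord] at ht; linarith [ht.2])
    refine le_trans (le_of_eq ?_) (measure_mono hsub)
    rw [Real.volume_Icc]
    congr 1
    ring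

theorem norm_sum_int_smul_le (m : Fin n → ℤ) {K : ℝ} (hm : ∀ i, |(m i : ℝ)| ≤ K) :
    ‖∑ i : Fin n, (m i : ℝ) • v i.castSucc‖ ≤ K * ∑ i : Fin n, ‖v i.castSucc‖ := by
  rw [Finset.mul_sum]
  refine norm_sum_le_of_le _ fun i _ => ?_
  rw [norm_smul]
  gcongr
  exact hm i

theorem lineOffset_sub (x : EuclideanSpace ℝ (Fin (n + 1))) (m m' : Fin n → ℤ) :
    lineOffset v x m - lineOffset v x m' =
      ∑ i : Fin n, ((m - m' : Fin n → ℤ) i : ℝ) • v i.castSucc := by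
  simp [lineOffset, sub_smul]

/-- The uniform set of lines is non-degenerate: a snake that runs up and down along consecutive
chords has total overhead `O(a^(n + 1/2))`. -/
theorem nonDegenerate_uniformSet
    (hvd : ∀ i, inner ℝ (v i) (v (Fin.last n)) = if i = Fin.last n then (1 : ℝ) else 0)
    {u : Fin n → EuclideanSpace ℝ (Fin (n + 1))}
    (hu : ∀ i j, inner ℝ (u i) (v j) = if i.castSucc = j then 2 * Real.pi else 0) :
    NonDegenerate (uniformSet v) := by
  intro x
  obtain ⟨V, hV⟩ : ∃ y, y = ∑ i : Fin n, ‖v i.castSucc‖ := ⟨_, rfl⟩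
  have hV0 : 0 ≤ V := hV ▸ Finset.sum_nonneg fun _ _ => norm_nonneg _
  obtain ⟨A, hA⟩ : ∃ y, y = ∑ i : Fin n, ‖u i‖ := ⟨_, rfl⟩
  have hA0 : 0 ≤ A := hA ▸ Finset.sum_nonneg fun _ _ => norm_nonneg _
  obtain ⟨c, hc⟩ : ∃ y, y = inner ℝ x (v (Fin.last n)) := ⟨_, rfl⟩
  have hvn := norm_last_eq_one hvd
  have hx' : ‖x - c • v (Fin.last n)‖ ≤ 2 * ‖x‖ := by
    refine (norm_sub_le _ _).trans ?_
    rw [norm_smul, hvn, mul_one, Real.norm_eq_abs]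
    have := abs_real_inner_le_norm x (v (Fin.last n))
    rw [hvn, mul_one, ← hc] at this
    linarith
  obtain ⟨C₁, hC₁⟩ : ∃ y, y = A * (1 + ‖x‖) + 1 := ⟨_, rfl⟩
  have hC₁0 : 0 ≤ C₁ := by rw [hC₁]; positivity
  obtain ⟨C₂, hC₂⟩ : ∃ y, y = 2 * C₁ + 1 := ⟨_, rfl⟩
  obtain ⟨C₃, hC₃⟩ : ∃ y, y = V * (2 * (C₁ * V + 2 * ‖x‖)) := ⟨_, rfl⟩
  have hC₃0 : 0 ≤ C₃ := by rw [hC₃]; positivity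
  -- At most `(C₂ (a + 1))^n` crossings, each of length at most `(V + √C₃) √(a + 1)`. Using `a + 1`
  -- makes the bounds valid for small `a` too.
  refine ⟨fun a => (C₂ ^ n * (V + √C₃)) * ((a + 1) ^ n * √(a + 1)),
    isLittleO_add_one_pow_mul_sqrt _ n, fun a ha => ?_⟩
  -- For `y` on line `m` in the ball, `2π |m_i| = |⟨u_i, y⟩| ≤ A (a + ‖x‖)`, so the box of radius
  -- `K` contains every line that meets the ball.
  obtain ⟨K, hK⟩ : ∃ y, y = ⌈A * (a + ‖x‖)⌉₊ := ⟨_, rfl⟩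
  have hKle : (K : ℝ) ≤ C₁ * (a + 1) := by
    have h1 := (Nat.ceil_lt_add_one (show 0 ≤ A * (a + ‖x‖) by positivity)).le
    rw [← hK] at h1
    refine h1.trans ?_
    have h2 : 0 ≤ A * ‖x‖ * a := by positivity
    rw [hC₁]
    nlinarith
  set g := snakePath K n with hg
  have hbox : ∀ j i, |(g j i : ℝ)| ≤ K := fun j i => by
    exact_mod_cast snakePath_abs_le K n j i
  have hstep : ∀ j, ‖lineOffset v x (g (j + 1)) - lineOffset v x (g j)‖ ≤ V := by
    intro j
    rw [lineOffset_sub]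
    refine (norm_sum_int_smul_le (K := 1) _ fun i => ?_).trans_eq (by rw [one_mul, hV])
    exact_mod_cast snakePath_step K n j i
  have hoff : ∀ j, ‖lineOffset v x (g j)‖ ≤ (C₁ * V + 2 * ‖x‖) * (a + 1) := by
    intro j
    refine (norm_sub_le _ _).trans ?_
    have h1 := norm_sum_int_smul_le (v := v) (g j) (hbox j)
    rw [← hV] at h1
    rw [← hc]
    have h2 : (K : ℝ) * V ≤ C₁ * (a + 1) * V := by gcongr
    have h3 : 0 ≤ ‖x‖ * a := by positivity
    nlinarith
  have hchord : ∀ j, |halfChord v x a (g (j + 1)) - halfChord v x a (g j)| ≤ √C₃ * √(a + 1) := by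
    intro j
    refine (Real.abs_sqrt_sub_sqrt_le _ _).trans ?_
    rw [← Real.sqrt_mul hC₃0]
    apply Real.sqrt_le_sqrt
    rw [show a ^ 2 - ‖lineOffset v x (g (j + 1))‖ ^ 2 - (a ^ 2 - ‖lineOffset v x (g j)‖ ^ 2) =
      -((‖lineOffset v x (g (j + 1))‖ - ‖lineOffset v x (g j)‖) *
        (‖lineOffset v x (g (j + 1))‖ + ‖lineOffset v x (g j)‖)) by ring, abs_neg, abs_mul,
      abs_of_nonneg (add_nonneg (norm_nonneg _) (norm_nonneg _)), hC₃, mul_assoc]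
    gcongr
    · exact (abs_norm_sub_norm_le _ _).trans (hstep j)
    · linarith [hoff j, hoff (j + 1)]
  -- The signs run `-, +, +, -, -, …`: vertices `2j` and `2j + 1` are opposite ends of chord `j`,
  -- and each crossing stays on one side.
  set σ : ℕ → ℝ := fun k => if (k + 1) / 2 % 2 = 0 then -1 else 1 with hσ
  set P : ℕ → EuclideanSpace ℝ (Fin (n + 1)) := fun k =>
    uniformSet v (g (k / 2)) (c + σ k * halfChord v x a (g (k / 2))) with hP
  have hPsub : ∀ k, P k = lineOffset v x (g (k / 2)) +
      (σ k * halfChord v x a (g (k / 2))) • v (Fin.last n) + x := by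
    intro k
    rw [← sub_eq_iff_eq_add, hP, uniformSet_sub_eq, ← hc, add_sub_cancel_left]
  have hs0 : ∀ m, 0 ≤ halfChord v x a m := fun m => Real.sqrt_nonneg _
  have hσabs : ∀ k, |σ k| = 1 := fun k => by simp only [hσ]; split_ifs <;> simp
  have hσodd : ∀ j, σ (2 * j + 1) = -σ (2 * j) := by
    intro j
    simp only [hσ]
    have h1 : (2 * j + 1 + 1) / 2 = j + 1 := by omega
    have h2 : (2 * j + 1) / 2 = j := by omega
    rw [h1, h2]
    split_ifs <;> first | omega | norm_num
  have hσeven : ∀ j, σ (2 * j + 1 + 1) = σ (2 * j + 1) := by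
    intro j
    simp only [hσ]
    have h1 : (2 * j + 1 + 1) / 2 = j + 1 := by omega
    have h2 : (2 * j + 1 + 1 + 1) / 2 = j + 1 := by omega
    rw [h1, h2]
  have hd0 : ∀ j, 2 * j / 2 = j := fun j => by omega
  have hd1 : ∀ j, (2 * j + 1) / 2 = j := fun j => by omega
  have hd2 : ∀ j, (2 * j + 1 + 1) / 2 = j + 1 := fun j => by omega
  have halong : ∀ j, edist (P (2 * j)) (P (2 * j + 1)) =
      ENNReal.ofReal (2 * halfChord v x a (g j)) := by
    intro j
    rw [edist_dist, dist_eq_norm, hPsub, hPsub, hd0, hd1, hσodd, add_sub_add_right_eq_sub,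
      add_sub_add_left_eq_sub, ← sub_smul, norm_smul, hvn, mul_one, Real.norm_eq_abs,
      show σ (2 * j) * halfChord v x a (g j) - -σ (2 * j) * halfChord v x a (g j) =
        σ (2 * j) * (2 * halfChord v x a (g j)) by ring, abs_mul, hσabs, one_mul,
      abs_of_nonneg (by linarith [hs0 (g j)])]
  have hacross : ∀ j, edist (P (2 * j + 1)) (P (2 * j + 1 + 1)) ≤
      ENNReal.ofReal ((V + √C₃) * √(a + 1)) := by
    intro j
    rw [edist_comm, edist_dist, dist_eq_norm, hPsub, hPsub, hd1, hd2, hσeven,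
      add_sub_add_right_eq_sub, add_sub_add_comm, ← sub_smul, ← mul_sub]
    refine ENNReal.ofReal_le_ofReal ((norm_add_le _ _).trans ?_)
    rw [norm_smul, hvn, mul_one, Real.norm_eq_abs, abs_mul, hσabs, one_mul, add_mul]
    refine add_le_add ((hstep j).trans ?_) (hchord j)
    exact le_mul_of_one_le_right hV0 (Real.one_le_sqrt.2 (by linarith))
  -- The count includes one superfluous crossing after the last chord; it obeys the same bound.
  obtain ⟨γ, hγ, hlen⟩ := exists_polygonal_curve P (2 * (2 * K + 1) ^ n)
  refine ⟨γ, fun m t hmt => ?_, hlen.trans ?_⟩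
  · obtain ⟨j, hj, rfl⟩ := exists_snakePath_eq K n m fun i => by
      have h1 : |inner ℝ (u i) (uniformSet v m t)| ≤ A * (a + ‖x‖) := by
        refine (abs_real_inner_le_norm _ _).trans ?_
        gcongr
        · rw [hA]
          exact Finset.single_le_sum (f := fun i => ‖u i‖) (fun _ _ => norm_nonneg _)
            (Finset.mem_univ i)
        · calc ‖uniformSet v m t‖ = ‖(uniformSet v m t - x) + x‖ := by rw [sub_add_cancel]
            _ ≤ a + ‖x‖ := (norm_add_le _ _).trans (by gcongr)
      rw [inner_uniformSet hu, abs_mul, abs_of_pos Real.two_pi_pos] at h1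
      have h2 : |(m i : ℝ)| ≤ K := by
        refine le_trans ?_ (h1.trans (hK ▸ Nat.le_ceil _))
        exact le_mul_of_one_le_left (abs_nonneg _) (by linarith [Real.pi_gt_three])
      exact_mod_cast h2
    refine hγ (2 * j) (by omega) ?_
    have ht := (norm_uniformSet_sub_le_iff hvd ha.le _ t).1 hmt
    rw [← hc] at ht
    have ht' : |t - c| ≤ halfChord v x a (g j) := Real.abs_le_sqrt ht
    rw [abs_le] at ht'
    simp only [hP, hd0, hd1]
    refine uniformSet_mem_segment _ ?_
    rw [hσodd, segment_eq_uIcc, mem_uIcc]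
    rcases eq_or_eq_neg_of_abs_eq (hσabs (2 * j)) with h | h
    · right
      constructor <;> rw [h] <;> linarith
    · left
      constructor <;> rw [h] <;> linarith
  · rw [Finset.sum_range_two_mul, Finset.sum_add_distrib]
    refine add_le_add ?_ ?_
    · refine le_trans ?_ (sum_halfChord_le_arcLengthInBall hvd x ha.le)
      simp only [halong]
      -- Injectivity matters here: each chord is charged only once against the arc length.
      rw [← Finset.sum_image (f := fun m => ENNReal.ofReal (2 * halfChord v x a m))
        (snakePath_injOn K n)]
      exact ENNReal.sum_le_tsum _
    · refine (Finset.sum_le_sum fun j _ => hacross j).trans ?_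
      rw [Finset.sum_const, Finset.card_range, nsmul_eq_mul, ← ENNReal.ofReal_natCast,
        ← ENNReal.ofReal_mul (by positivity)]
      apply ENNReal.ofReal_le_ofReal
      have h1 : ((2 * K + 1 : ℕ) : ℝ) ≤ C₂ * (a + 1) := by
        push_cast
        rw [hC₂]
        linarith
      calc (((2 * K + 1) ^ n : ℕ) : ℝ) * ((V + √C₃) * √(a + 1))
          ≤ (C₂ * (a + 1)) ^ n * ((V + √C₃) * √(a + 1)) := by
            rw [Nat.cast_pow]
            gcongr
        _ = _ := by rw [mul_pow]; ring

end Chords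

theorem theorem4 (n : ℕ) (hn : 1 ≤ n)
    (v : Fin (n + 1) → EuclideanSpace ℝ (Fin (n + 1)))
    (hv : LinearIndependent ℝ v)
    (hvd : ∀ i, inner ℝ (v i) (v (Fin.last n)) = if i = Fin.last n then (1 : ℝ) else 0)
    (u : Fin n → EuclideanSpace ℝ (Fin (n + 1)))
    (hu : ∀ i j, inner ℝ (u i) (v j) = if i.castSucc = j then 2 * Real.pi else 0)
    (Ω : Set (EuclideanSpace ℝ (Fin (n + 1))))
    (hcompact : IsCompact Ω) (hconvex : Convex ℝ Ω) (hsymm : ∀ ω ∈ Ω, -ω ∈ Ω) :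
    ((∀ m : Fin n → ℤ, m ≠ 0 → (1 / 2 : ℝ) • ∑ i, (m i : ℝ) • u i ∉ Ω) →
      IsNyquistTrajectorySet Ω (uniformSet v)) ∧
    ((∃ m : Fin n → ℤ, m ≠ 0 ∧ (1 / 2 : ℝ) • ∑ i, (m i : ℝ) • u i ∈ interior Ω) →
      ¬ IsNyquistTrajectorySet Ω (uniformSet v)) := by
  refine ⟨fun hΩ => ⟨inferInstance,
    nyquistCondition_uniformSet hv hvd hu hcompact hconvex hsymm hΩ,
    nonDegenerate_uniformSet hvd hu⟩, ?_⟩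
  rintro ⟨m, hm, hmΩ⟩ ⟨-, ⟨Λ, hΛ, -, huniq⟩, -⟩
  obtain ⟨f, hf, hf0, hvan⟩ :=
    exists_bandlimitedField_vanishing_on_uniformSet hu hsymm hm hmΩ
  refine hf0 (huniq f hf 0 (bandlimitedFields.zero_mem Ω) fun y hy => ?_)
  obtain ⟨k, t, rfl⟩ := hΛ hy
  exact hvan k t
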